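/- Consider a finite set $V$ of sites with $q\ge 1$ states per site, and a finite family of terms $h_a$, $a\in M$, diagonal in the computational basis, each a tensor product of single-site real diagonal operators of operator norm at most $1$; the support $\operatorname{supp} h_a\subseteq V$ is the set of sites at which the tensor factor is not a multiple of the identity. Let $H=\sum_{a}\lambda_a h_a$ with $|\lambda_a|\le 1$ for all $a$. The *dual interaction graph* has vertex set $M$, with $a\neq b$ adjacent iff $\operatorname{supp}h_a\cap\operatorname{supp}h_b\neq\emptyset$; let $\mathfrak d\ge 1$ be an upper bound for its maximal degree, and put $$\beta_c(\mathfrak d)=\frac{1}{e(\mathfrak d+1)\bigl(1+e(\mathfrak d-1)\bigr)}.$$ Let $\rho=e^{-\beta H}/\operatorname{Tr}e^{-\beta H}$ be the Gibbs distribution, let $X,Y,Z\subseteq V$ be pairwise disjoint (not necessarily covering $V$), and let $\mathcal T=\bigotimes_{i\in Y}\mathcal T_i$, where each $\mathcal T_i$ is a $q\times q$ transition (stochastic) matrix acting on site $i$, all of whose entries are non-zero. Let $I(X:Z|\mathcal T[Y])=S(XY)+S(ZY)-S(Y)-S(XYZ)$ be the conditional mutual information of the distribution $\mathcal T[\rho]$,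 where $S(L)$ is the Shannon entropy of the marginal on $L$. A *cluster* is a finite multiset of terms; its weight is the number of its elements, counted with multiplicity. It is connected if it is non-empty and its terms induce a connected subgraph of the dual interaction graph, and it connects $X$ and $Z$ if its support meets both $X$ and $Z$. Let $d_{XZ}\in\mathbb N\cup\{\infty\}$ be the minimal weight of a connected cluster connecting $X$ and $Z$ ($\infty$ if there is none), and let $|\partial X|$ be the number of terms $h_a$ whose support meets both $X$ and $V\setminus X$; likewise $|\partial Z|$. **Theorem.** There are universal constants $c>0$ and $K>1$ such that, for all data as above and all $0<\beta\le\beta_c(\mathfrak d)$, $$I(X:Z|\mathcal T[Y])\;\le\; c\,\min(|\partial X|,|\partial Z|)\,e^{-d_{XZ}/\xi},\qquad \xi=\frac{1}{\ln\left(K\beta_c(\mathfrak d)/\beta\right)},$$ with the convention $e^{-\infty}=0$. In particular the Markov length $\xi$ is a function of $\beta/\beta_c$ alone, is bounded by $1/\ln K$, and $e^{-d_{XZ}/\xi}=(\beta/(K\beta_c))^{d_{XZ}}$. -/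

import Mathlib

namespace ClassicalCMI

open scoped Classical

noncomputable section

/-- Configurations of a system with site set `V` and `q` states per site: the computational
basis. An operator that is diagonal in this basis is identified with the real function of the
configuration that lists its diagonal entries. -/
abbrev Config (V : Type*) (q : ℕ) : Type _ := V → Fin q

/-- A Hamiltonian `H = ∑ a, coeff a • h a` that is diagonal in the computational basis. The terms
are labelled by `M`, the coefficients satisfy `|coeff a| ≤ 1`, and every `h a` is a tensor product
of single-site diagonal operators `factor a i` of operator norm at most one (the norm of a
diagonal operator is the largest absolute value of its diagonal entries). -/
structure DiagHamiltonian (V M : Type*) (q : ℕ) where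
  coeff : M → ℝ
  factor : M → V → Fin q → ℝ
  abs_coeff_le : ∀ a, |coeff a| ≤ 1
  abs_factor_le : ∀ a i x, |factor a i x| ≤ 1

namespace DiagHamiltonian

variable {V M : Type*} [Fintype V] [Fintype M] {q : ℕ} (H : DiagHamiltonian V M q)

/-- The diagonal of the term `h a`. -/
def term (a : M) (s : Config V q) : ℝ := ∏ i, H.factor a i (s i)

/-- The diagonal of `H`. -/
def energy (s : Config V q) : ℝ := ∑ a, H.coeff a * H.term a s

/-- The Gibbs distribution, the diagonal of `e^{-βH} / Tr e^{-βH}`. -/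
def gibbs (β : ℝ) (s : Config V q) : ℝ :=
  Real.exp (-β * H.energy s) / ∑ s', Real.exp (-β * H.energy s')

/-- The support of `h a`: the sites at which its tensor factor is not a multiple of the
identity. -/
def supp (a : M) : Finset V :=
  Finset.univ.filter fun i => ∃ x y, H.factor a i x ≠ H.factor a i y

/-- The dual interaction graph: its vertices are the terms of `H`, and two distinct terms are
adjacent when their supports overlap. -/
def dualGraph : SimpleGraph M where
  Adj a b := a ≠ b ∧ (H.supp a ∩ H.supp b).Nonempty
  symm := ⟨fun a b h => ⟨h.1.symm, by rw [Finset.inter_comm]; exact h.2⟩⟩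
  loopless := ⟨fun _ h => h.1 rfl⟩

/-- `|∂A|`: the number of terms that are supported both inside and outside `A`. -/
def boundarySize (A : Finset V) : ℕ :=
  (Finset.univ.filter fun a : M => (∃ i ∈ H.supp a, i ∈ A) ∧ ∃ i ∈ H.supp a, i ∉ A).card

/-- A cluster (a multiset of terms) is connected if its terms induce a connected subgraph of the
dual interaction graph; in particular it is not empty. -/
def IsConnectedCluster (W : Multiset M) : Prop :=
  (H.dualGraph.induce {a | a ∈ W}).Connected

/-- A cluster connects `A` and `B` if its support meets both of them. -/
def ClusterConnects (W : Multiset M) (A B : Finset V) : Prop :=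
  (∃ a ∈ W, (H.supp a ∩ A).Nonempty) ∧ ∃ b ∈ W, (H.supp b ∩ B).Nonempty

/-- The distance between `A` and `B`: the minimal weight (number of terms, counted with
multiplicity) of a connected cluster that connects `A` and `B`; it is `⊤` if there is none. -/
def clusterDist (A B : Finset V) : ℕ∞ :=
  ⨅ (W : Multiset M) (_ : H.IsConnectedCluster W ∧ H.ClusterConnects W A B), (W.card : ℕ∞)

end DiagHamiltonian

section Information

variable {V : Type*} [Fintype V] {q : ℕ}

/-- The distribution that arises from `P` when the transition matrix `T i` acts on every site `i`
of `Y`, independently, and nothing happens elsewhere. The entry `T i x x'` is the probability of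
moving from `x'` to `x`. -/
def applyTransition (T : V → Matrix (Fin q) (Fin q) ℝ) (Y : Finset V) (P : Config V q → ℝ)
    (s : Config V q) : ℝ :=
  ∑ s' : Config V q, (∏ i, (if i ∈ Y then T i else 1) (s i) (s' i)) * P s'

/-- The marginal of `P` on the sites in `L`. -/
def marginal (P : Config V q → ℝ) (L : Finset V) (u : L → Fin q) : ℝ :=
  ∑ s : Config V q, if (fun i : L => s i) = u then P s else 0

/-- The Shannon entropy (in nats) of the marginal of `P` on `L`. -/
def entropy (P : Config V q → ℝ) (L : Finset V) : ℝ :=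
  ∑ u : L → Fin q, Real.negMulLog (marginal P L u)

/-- The conditional mutual information `I(X : Z | Y)` of `P`. -/
def condMutualInfo (P : Config V q → ℝ) (X Z Y : Finset V) : ℝ :=
  entropy P (X ∪ Y) + entropy P (Z ∪ Y) - entropy P Y - entropy P (X ∪ Y ∪ Z)

end Information

/-- The critical inverse temperature `1 / (e (𝔡 + 1) (1 + e (𝔡 - 1)))`. -/
def betaC (𝔡 : ℕ) : ℝ :=
  1 / (Real.exp 1 * ((𝔡 : ℝ) + 1) * (1 + Real.exp 1 * ((𝔡 : ℝ) - 1)))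

/-- The Markov length `ξ = 1 / log (K β_c / β)`. -/
def markovLength (K : ℝ) (𝔡 : ℕ) (β : ℝ) : ℝ := 1 / Real.log (K * betaC 𝔡 / β)

/-- The factor `e^{-d/ξ}`, with `e^{-∞} = 0`. -/
def expDecay (d : ℕ∞) (ξ : ℝ) : ℝ := if d = ⊤ then 0 else Real.exp (-(d.toNat : ℝ) / ξ)

end

end ClassicalCMI

/-!
# Decay of the conditional mutual information of a locally transformed Gibbs distribution

For a fixed configuration `s`, the pointwise conditional mutual information of `𝒯[ρ]` is the mixed
second difference `log (Z_XYZ Z_Y / (Z_XY Z_ZY))`. Here `Z_L` is the partition function of `H`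
relative to a product measure: a site in `L ∩ Y` carries the row of its transition matrix selected
by `s`, another site in `L` is pinned to its value in `s`, and every other site is uniform
(`marginal_gibbs_eq`). The conditional mutual information is an average of such expressions, so a
bound that is uniform in `s` is enough (`condMutualInfo_le_of_forall`).

The second difference is continued to complex couplings `ζ b`, and three facts about it are
combined.

* **No zeros.** If all couplings have modulus at most `1 / (5𝔡²)`, adding one term changes any
  partition function relatively by at most `1 / 2` (`partition_ne_zero_and_ratio`). The proof is an
  induction on the number of terms, simultaneously for all product measures: conditioning on the
  support of a term `a` is again a product measure, and it has no effect on the partition function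
  once the neighbours of `a` are removed. A neighbour of `a` has at most `𝔡 - 1` neighbours after
  the removal of `a`, which is what makes the radius large enough for `𝔡 = 1`.
* **Boundedness.** Without the boundary terms of `X` the second difference is zero
  (`partition_sdiff_boundary`). Adding the boundary terms back one at a time, each of the four free
  energies changes by a principal logarithm of modulus at most `3 / 4` per term
  (`exists_log_ratio`), so the second difference is analytic and at most `3|∂X|`.
* **Order of vanishing.** `Z_XYZ Z_Y - Z_XY Z_ZY` is an expectation over two independent copies of
  the system. In a moment of order less than `d_XZ`, each product of terms involves too few terms
  to connect `X` and `Z`. Exchanging the two copies outside a set that separates `X` from `Z` then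
  leaves the product invariant and exchanges the two ways of imposing the conditions on `X` and
  `Z`, so that the contributions cancel (`moments_eq`). Hence the second difference vanishes to
  order `d_XZ` at `ζ = 0`.

By the Schwarz lemma the second difference at `ζ = 1` is at most `3|∂X| ρ ^ (-d_XZ)`, where `ρ` is
the radius of the disc. The couplings `β λ_a` allow `ρ = K β_c / β` with `K = 2e/5 > 1`. The bound
with `|∂Z|` follows by symmetry.
-/

namespace ClassicalCMI

open scoped Classical

noncomputable section

open Finset

/-! ### Product weights and two independent copies of the system -/

section Weights

variable {V : Type*} {q : ℕ}

/-- The site weights `w` are probability vectors. -/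
structure IsSiteProb (w : V → Fin q → ℝ) : Prop where
  nonneg : ∀ i x, 0 ≤ w i x
  sum_eq_one : ∀ i, ∑ x, w i x = 1

/-- The involution of pairs of configurations that exchanges the two members of the pair on all
sites outside `A`. -/
def swapOutside (A : Finset V) : Equiv.Perm (Config V q × Config V q) where
  toFun p := (A.piecewise p.1 p.2, A.piecewise p.2 p.1)
  invFun p := (A.piecewise p.1 p.2, A.piecewise p.2 p.1)
  left_inv p := by
    ext i <;> by_cases h : i ∈ A <;> simp [h]
  right_inv p := by
    ext i <;> by_cases h : i ∈ A <;> simp [h]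

lemma IsSiteProb.piecewise {w w' : V → Fin q → ℝ} (hw : IsSiteProb w) (hw' : IsSiteProb w')
    (A : Finset V) : IsSiteProb (A.piecewise w w') where
  nonneg i x := by by_cases h : i ∈ A <;> simp [h, hw.nonneg, hw'.nonneg]
  sum_eq_one i := by by_cases h : i ∈ A <;> simp [h, hw.sum_eq_one, hw'.sum_eq_one]

/-- The point mass at `σ` on the sites of `A`, and the weights `w` elsewhere. -/
def conditionOn (A : Finset V) (σ : Config V q) (w : V → Fin q → ℝ) : V → Fin q → ℝ :=
  A.piecewise (fun i => Pi.single (σ i) 1) w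

lemma isSiteProb_single (σ : Config V q) :
    IsSiteProb (fun i => (Pi.single (σ i) 1 : Fin q → ℝ)) where
  nonneg i x := by
    by_cases h : x = σ i
    · subst h; simp
    · simp [h]
  sum_eq_one i := by simp

lemma IsSiteProb.conditionOn {w : V → Fin q → ℝ} (hw : IsSiteProb w) (A : Finset V)
    (σ : Config V q) : IsSiteProb (conditionOn A σ w) :=
  (isSiteProb_single σ).piecewise hw A

variable [Fintype V]

/-- The product weight of a configuration, for site weights `w`. -/
def weight (w : V → Fin q → ℝ) (s : Config V q) : ℝ := ∏ i, w i (s i)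

lemma weight_nonneg {w : V → Fin q → ℝ} (hw : ∀ i x, 0 ≤ w i x) (s : Config V q) :
    0 ≤ weight w s := prod_nonneg fun i _ => hw i _

lemma sum_weight (w : V → Fin q → ℝ) : ∑ s, weight w s = ∏ i, ∑ x, w i x :=
  (Fintype.prod_sum _).symm

lemma IsSiteProb.sum_weight {w : V → Fin q → ℝ} (hw : IsSiteProb w) :
    ∑ s, weight w s = 1 := by
  simp [ClassicalCMI.sum_weight, hw.sum_eq_one]

/-- Exchanging two independent copies of the system outside `A` exchanges their site weights
there. -/
lemma sum_weight_mul_weight_swapOutside (A : Finset V) (w w' : V → Fin q → ℝ)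
    (F : Config V q × Config V q → ℂ) :
    ∑ p : Config V q × Config V q, ((weight w p.1 * weight w' p.2 : ℝ) : ℂ) * F p =
      ∑ p : Config V q × Config V q,
        ((weight (A.piecewise w w') p.1 * weight (A.piecewise w' w) p.2 : ℝ) : ℂ) *
          F (swapOutside A p) := by
  rw [← Equiv.sum_comp (swapOutside A)]
  refine sum_congr rfl fun p _ => ?_
  congr 2
  simp only [weight, ← prod_mul_distrib, swapOutside, Equiv.coe_fn_mk]
  refine prod_congr rfl fun i _ => ?_
  by_cases h : i ∈ A <;> simp [h, mul_comm]

lemma eq_of_weight_conditionOn_ne_zero {A : Finset V} {σ s : Config V q} {w : V → Fin q → ℝ}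
    (h : weight (conditionOn A σ w) s ≠ 0) : ∀ i ∈ A, s i = σ i := by
  intro i hi
  by_contra hne
  refine h (prod_eq_zero (mem_univ i) ?_)
  simp [ClassicalCMI.conditionOn, hi, hne]

/-- The law of total probability. The sum runs over full configurations `σ`, although only the
restriction of `σ` to `A` matters. -/
lemma sum_weight_mul_conditionOn {w : V → Fin q → ℝ} (hw : IsSiteProb w) (A : Finset V)
    (s : Config V q) : ∑ σ, weight w σ * weight (conditionOn A σ w) s = weight w s := by
  have h : ∀ σ : Config V q, weight w σ * weight (conditionOn A σ w) s =
      ∏ i, w i (σ i) * (if i ∈ A then (if s i = σ i then 1 else 0) else w i (s i)) := by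
    intro σ
    simp only [weight, ← prod_mul_distrib]
    refine prod_congr rfl fun i _ => ?_
    by_cases h : i ∈ A <;> simp [conditionOn, h, Pi.single_apply]
  simp only [h]
  rw [← Fintype.prod_sum fun i x =>
    w i x * (if i ∈ A then (if s i = x then 1 else 0) else w i (s i))]
  refine prod_congr rfl fun i _ => ?_
  by_cases h : i ∈ A
  · simp [h]
  · simp [h, ← sum_mul, hw.sum_eq_one]

lemma sum_weight_mul_eq_sum_conditionOn {w : V → Fin q → ℝ} (hw : IsSiteProb w) (A : Finset V)
    (F : Config V q → ℂ) :
    ∑ s, (weight w s : ℂ) * F s =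
      ∑ σ, (weight w σ : ℂ) * ∑ s, (weight (conditionOn A σ w) s : ℂ) * F s := by
  simp only [mul_sum]
  rw [sum_comm]
  refine sum_congr rfl fun s _ => ?_
  rw [← sum_weight_mul_conditionOn hw A s]
  push_cast
  rw [sum_mul]
  exact sum_congr rfl fun σ _ => mul_assoc _ _ _

/-- The expectation of a function that does not depend on the sites in `A` does not depend on the
weights of these sites. -/
lemma sum_weight_mul_eq_of_eq_off {w w' : V → Fin q → ℝ} (hw : IsSiteProb w)
    (hw' : IsSiteProb w') {A : Finset V} (hww' : ∀ i ∉ A, w i = w' i) {F : Config V q → ℂ}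
    (hF : ∀ s s' : Config V q, (∀ i ∉ A, s i = s' i) → F s = F s') :
    ∑ s, (weight w s : ℂ) * F s = ∑ s, (weight w' s : ℂ) * F s := by
  -- A second, independent copy is added, and the copies are exchanged on the sites of `A`.
  have key : ∀ u u' : V → Fin q → ℝ, IsSiteProb u' → ∑ s, (weight u s : ℂ) * F s =
      ∑ p : Config V q × Config V q, ((weight u p.1 * weight u' p.2 : ℝ) : ℂ) * F p.1 := by
    intro u u' hu'
    rw [Fintype.sum_prod_type]
    refine sum_congr rfl fun s _ => ?_
    have : (∑ t, (weight u' t : ℂ)) = 1 := by exact_mod_cast hu'.sum_weight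
    simp only [Complex.ofReal_mul]
    rw [← sum_mul, ← mul_sum, this, mul_one]
  have h1 : (univ \ A).piecewise w w' = w' := by
    ext i x
    by_cases h : i ∈ A
    · simp [h]
    · simp [h, hww' i h]
  have h2 : (univ \ A).piecewise w' w = w := by
    ext i x
    by_cases h : i ∈ A
    · simp [h]
    · simp [h, hww' i h]
  rw [key w w' hw', key w' w hw, sum_weight_mul_weight_swapOutside (univ \ A), h1, h2]
  refine sum_congr rfl fun p _ => ?_
  congr 1
  refine hF _ _ fun i hi => ?_
  simp [swapOutside, hi]

/-- The site weights `w₁` and `w₀` agree outside `X ∪ Z`. If `A` separates `X` from `Z`, then a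
function of two independent copies that is invariant under exchanging them outside `A` has the same
expectation whether the weights `w₁` are used in one copy on both `X` and `Z`, or in one copy on `X`
and in the other on `Z`. -/
lemma sum_weight_mul_weight_piecewise {w₁ w₀ : V → Fin q → ℝ} {X Z A : Finset V}
    (hw : ∀ i, i ∉ X → i ∉ Z → w₁ i = w₀ i) (hXA : X ⊆ A) (hZA : Disjoint Z A)
    {F : Config V q × Config V q → ℂ} (hF : ∀ p, F (swapOutside A p) = F p) :
    ∑ p : Config V q × Config V q, ((weight w₁ p.1 * weight w₀ p.2 : ℝ) : ℂ) * F p =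
      ∑ p : Config V q × Config V q,
        ((weight (X.piecewise w₁ w₀) p.1 * weight (X.piecewise w₀ w₁) p.2 : ℝ) : ℂ) * F p := by
  have h1 : A.piecewise w₁ w₀ = X.piecewise w₁ w₀ := by
    ext i x
    by_cases hX : i ∈ X
    · simp [hX, hXA hX]
    · by_cases hA : i ∈ A
      · simp [hX, hA, hw i hX fun h => disjoint_left.1 hZA h hA]
      · simp [hX, hA]
  have h0 : A.piecewise w₀ w₁ = X.piecewise w₀ w₁ := by
    ext i x
    by_cases hX : i ∈ X
    · simp [hX, hXA hX]
    · by_cases hA : i ∈ A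
      · simp [hX, hA, hw i hX fun h => disjoint_left.1 hZA h hA]
      · simp [hX, hA]
  rw [sum_weight_mul_weight_swapOutside A, h1, h0]
  simp only [hF]

end Weights

/-! ### Absence of zeros of the partition function at weak complex couplings -/

namespace DiagHamiltonian

variable {V M : Type*} [Fintype V] {q : ℕ} (H : DiagHamiltonian V M q)

lemma abs_term_le (a : M) (s : Config V q) : |H.term a s| ≤ 1 := by
  rw [term, abs_prod]
  exact prod_le_one (fun _ _ => abs_nonneg _) fun i _ => H.abs_factor_le a i _

lemma term_congr {a : M} {s s' : Config V q} (h : ∀ i ∈ H.supp a, s i = s' i) :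
    H.term a s = H.term a s' := by
  refine prod_congr rfl fun i _ => ?_
  by_cases hi : i ∈ H.supp a
  · rw [h i hi]
  · simp only [supp, mem_filter, mem_univ, true_and, not_exists, not_not] at hi
    exact hi _ _

/-- The partition function of the terms in `S`, with complex couplings `b`, relative to the product
measure with site weights `w`. -/
def partition (w : V → Fin q → ℝ) (b : M → ℂ) (S : Finset M) : ℂ :=
  ∑ s, (weight w s : ℂ) * Complex.exp (∑ a ∈ S, b a * H.term a s)

lemma partition_empty {w : V → Fin q → ℝ} (hw : IsSiteProb w) (b : M → ℂ) :
    H.partition w b ∅ = 1 := by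
  simp only [partition, sum_empty, Complex.exp_zero, mul_one]
  exact_mod_cast hw.sum_weight

lemma partition_conditionOn_of_disjoint {w : V → Fin q → ℝ} (hw : IsSiteProb w) (b : M → ℂ)
    {A : Finset V} (σ : Config V q) {S : Finset M} (hS : ∀ a ∈ S, Disjoint (H.supp a) A) :
    H.partition (conditionOn A σ w) b S = H.partition w b S := by
  refine sum_weight_mul_eq_of_eq_off (hw.conditionOn A σ) hw (A := A) ?_ ?_
  · intro i hi
    simp [conditionOn, hi]
  · intro s s' h
    congr 1
    refine sum_congr rfl fun a ha => ?_
    rw [H.term_congr fun i hi => h i (disjoint_left.1 (hS a ha) hi)]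

/-- Adding the term `a` changes the partition function by an average, over the configurations `σ`
of the support of `a`, of the partition functions conditioned on `σ`. -/
lemma partition_insert_sub {w : V → Fin q → ℝ} (hw : IsSiteProb w) (b : M → ℂ) {a : M}
    {S : Finset M} (ha : a ∉ S) :
    H.partition w b (insert a S) - H.partition w b S =
      ∑ σ, (weight w σ : ℂ) * ((Complex.exp (b a * H.term a σ) - 1) *
        H.partition (conditionOn (H.supp a) σ w) b S) := by
  have h : H.partition w b (insert a S) - H.partition w b S = ∑ s, (weight w s : ℂ) *
      ((Complex.exp (b a * H.term a s) - 1) * Complex.exp (∑ a ∈ S, b a * H.term a s)) := by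
    rw [partition, partition, ← sum_sub_distrib]
    refine sum_congr rfl fun s _ => ?_
    rw [sum_insert ha, Complex.exp_add]
    ring
  rw [h, sum_weight_mul_eq_sum_conditionOn hw (H.supp a)]
  refine sum_congr rfl fun σ _ => ?_
  congr 1
  rw [partition, mul_sum]
  refine sum_congr rfl fun s _ => ?_
  by_cases hs : weight (conditionOn (H.supp a) σ w) s = 0
  · simp [hs]
  · rw [H.term_congr (eq_of_weight_conditionOn_ne_zero hs)]
    ring

lemma norm_exp_mul_term_sub_one_le {z : ℂ} {R : ℝ} (hz : ‖z‖ ≤ R) (a : M) (s : Config V q) :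
    ‖Complex.exp (z * H.term a s) - 1‖ ≤ Real.exp R - 1 := by
  have h1 := Complex.norm_exp_sub_sum_le_exp_norm_sub_sum (z * H.term a s) 1
  simp only [range_one, sum_singleton, pow_zero, Nat.factorial_zero, Nat.cast_one, div_one] at h1
  refine h1.trans (sub_le_sub_right (Real.exp_le_exp.2 ?_) 1)
  rw [norm_mul, Complex.norm_real, Real.norm_eq_abs]
  calc ‖z‖ * |H.term a s| ≤ ‖z‖ * 1 := by gcongr; exact H.abs_term_le a s
    _ ≤ R := by simpa using hz

variable [Fintype M]

/-- The terms that are adjacent to `a` in the dual interaction graph. -/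
def nbrs (a : M) : Finset M := univ.filter fun b => H.dualGraph.Adj a b

lemma card_nbrs (a : M) : (H.nbrs a).card = (H.dualGraph.neighborSet a).ncard := by
  rw [← Set.ncard_coe_finset]
  congr 1
  ext b
  simp [nbrs]

/-- Comparison of two partition functions that differ by the terms in `N`, one term at a time. -/
lemma norm_partition_sdiff_bounds {w : V → Fin q → ℝ} {b : M → ℂ} {δ : ℝ} {n : ℕ}
    (hδ1 : δ ≤ 1) {S : Finset M}
    (hstep : ∀ S' ⊆ S, ∀ a ∈ S', (H.nbrs a ∩ S').card ≤ n →
      ‖H.partition w b S' - H.partition w b (S'.erase a)‖ ≤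
        δ * ‖H.partition w b (S'.erase a)‖)
    {N : Finset M} (hN : N ⊆ S) (hdeg : ∀ a ∈ N, (H.nbrs a ∩ S).card ≤ n) :
    (1 - δ) ^ N.card * ‖H.partition w b (S \ N)‖ ≤ ‖H.partition w b S‖ ∧
      ‖H.partition w b S‖ ≤ (1 + δ) ^ N.card * ‖H.partition w b (S \ N)‖ := by
  induction N using Finset.induction_on with
  | empty => simp
  | insert a N ha ih =>
    obtain ⟨ih1, ih2⟩ := ih ((subset_insert a N).trans hN)
      fun c hc => hdeg c (mem_insert_of_mem hc)
    have haS : a ∈ S \ N := mem_sdiff.2 ⟨hN (mem_insert_self a N), ha⟩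
    have hs := hstep (S \ N) sdiff_subset a haS
      ((card_le_card (inter_subset_inter_left sdiff_subset)).trans
        (hdeg a (mem_insert_self a N)))
    have he : (S \ N).erase a = S \ insert a N := by
      ext x; simp only [mem_erase, mem_sdiff, mem_insert]; tauto
    rw [he] at hs
    rw [card_insert_of_notMem ha, pow_succ, pow_succ]
    set z := H.partition w b (S \ N)
    set z' := H.partition w b (S \ insert a N)
    have h1 : (1 - δ) * ‖z'‖ ≤ ‖z‖ := by
      have := norm_sub_norm_le z' z
      rw [norm_sub_rev] at this
      linarith
    have h2 : ‖z‖ ≤ (1 + δ) * ‖z'‖ := by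
      have := norm_sub_norm_le z z'
      linarith
    have hz' := norm_nonneg z'
    constructor
    · rw [mul_assoc]
      exact le_trans (mul_le_mul_of_nonneg_left h1 (pow_nonneg (by linarith) _)) ih1
    · -- The sign of `δ` is only known when `z'` does not vanish.
      rcases eq_or_lt_of_le hz' with h0 | h0
      · have hz0 : ‖z‖ = 0 := le_antisymm (by rw [← h0] at h2; simpa using h2) (norm_nonneg _)
        rw [hz0] at ih2
        rw [← h0]
        simpa using ih2
      · have hδ : 0 ≤ δ := nonneg_of_mul_nonneg_left ((norm_nonneg _).trans hs) h0
        rw [mul_assoc]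
        exact ih2.trans (mul_le_mul_of_nonneg_left h2 (by positivity))

/-- If removing the neighbours of `a` changes partition functions by at most the factors
`(1 ± δ) ^ k`, uniformly in the site weights, then the relative change upon adding `a` is small:
conditioning on the support of `a` has no effect once the neighbours of `a` are gone. -/
lemma norm_partition_insert_sub_le {b : M → ℂ} {ε δ : ℝ} {k : ℕ} (hδ0 : 0 ≤ δ) (hδ1 : δ < 1)
    {a : M} (hε : ∀ s, ‖Complex.exp (b a * H.term a s) - 1‖ ≤ ε)
    {S : Finset M} (ha : a ∉ S) (hk : (H.nbrs a ∩ S).card ≤ k)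
    (hchain : ∀ w : V → Fin q → ℝ, IsSiteProb w →
      (1 - δ) ^ (H.nbrs a ∩ S).card * ‖H.partition w b (S \ (H.nbrs a ∩ S))‖ ≤
        ‖H.partition w b S‖ ∧
      ‖H.partition w b S‖ ≤
        (1 + δ) ^ (H.nbrs a ∩ S).card * ‖H.partition w b (S \ (H.nbrs a ∩ S))‖)
    {w : V → Fin q → ℝ} (hw : IsSiteProb w) :
    ‖H.partition w b (insert a S) - H.partition w b S‖ ≤
      ε * ((1 + δ) / (1 - δ)) ^ k * ‖H.partition w b S‖ := by
  set N := H.nbrs a ∩ S with hNdef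
  have h1δ : 0 < 1 - δ := by linarith
  have hcond : ∀ σ, ‖H.partition (conditionOn (H.supp a) σ w) b S‖ ≤
      ((1 + δ) / (1 - δ)) ^ k * ‖H.partition w b S‖ := by
    intro σ
    have h1 := (hchain _ (hw.conditionOn (H.supp a) σ)).2
    have h2 := (hchain _ hw).1
    rw [H.partition_conditionOn_of_disjoint hw b σ (S := S \ N)] at h1
    · have h3 : ‖H.partition w b (S \ N)‖ ≤ ‖H.partition w b S‖ / (1 - δ) ^ N.card := by
        rw [le_div_iff₀ (by positivity), mul_comm]
        exact h2
      calc _ ≤ (1 + δ) ^ N.card * (‖H.partition w b S‖ / (1 - δ) ^ N.card) :=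
            h1.trans (by gcongr)
        _ = ((1 + δ) / (1 - δ)) ^ N.card * ‖H.partition w b S‖ := by rw [div_pow]; ring
        _ ≤ _ := by
            gcongr
            rw [le_div_iff₀ h1δ]
            linarith
    · intro c hc
      rw [mem_sdiff] at hc
      by_contra hd
      refine hc.2 (mem_inter.2 ⟨?_, hc.1⟩)
      refine mem_filter.2 ⟨mem_univ c, fun h => ha (h ▸ hc.1), ?_⟩
      rwa [inter_comm, ← not_disjoint_iff_nonempty_inter]
  rw [H.partition_insert_sub hw b ha]
  calc _ ≤ ∑ σ, weight w σ * (ε * (((1 + δ) / (1 - δ)) ^ k * ‖H.partition w b S‖)) := by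
        refine (norm_sum_le _ _).trans (sum_le_sum fun σ _ => ?_)
        have hwσ := weight_nonneg hw.nonneg σ
        rw [norm_mul, norm_mul, Complex.norm_real, Real.norm_eq_abs, abs_of_nonneg hwσ]
        have hε0 : 0 ≤ ε := (norm_nonneg _).trans (hε σ)
        gcongr
        · exact hε σ
        · exact hcond σ
    _ = _ := by rw [← sum_mul, hw.sum_weight]; ring

/-- With `δ = 1 / (4𝔡)`, Bernoulli's inequality bounds the growth factor that `k ≤ 𝔡` neighbours
produce. -/
lemma growth_factor_le {𝔡 : ℕ} (h𝔡 : 1 ≤ 𝔡) {k : ℕ} (hk : k ≤ 𝔡) :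
    ((1 + 1 / (4 * (𝔡 : ℝ))) / (1 - 1 / (4 * (𝔡 : ℝ)))) ^ k ≤ 2 * 𝔡 / (2 * 𝔡 - k) := by
  have hd : (1 : ℝ) ≤ 𝔡 := by exact_mod_cast h𝔡
  have hk' : (k : ℝ) ≤ 𝔡 := by exact_mod_cast hk
  have e : (1 + 1 / (4 * (𝔡 : ℝ))) / (1 - 1 / (4 * (𝔡 : ℝ))) =
      (1 + -(2 / (4 * (𝔡 : ℝ) + 1)))⁻¹ := by
    have h1 : (4 * 𝔡 - 1 : ℝ) ≠ 0 := by linarith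
    have h2 : (4 * 𝔡 + 1 : ℝ) ≠ 0 := by linarith
    have h3 : (1 - 1 / (4 * (𝔡 : ℝ))) = (4 * 𝔡 - 1) / (4 * 𝔡) := by field_simp
    have h4 : (1 + -(2 / (4 * (𝔡 : ℝ) + 1))) = (4 * 𝔡 - 1) / (4 * 𝔡 + 1) := by field_simp; ring
    rw [h3, h4]
    field_simp
  have hB := one_add_mul_le_pow (a := -(2 / (4 * (𝔡 : ℝ) + 1)))
    (by
      have : 2 / (4 * (𝔡 : ℝ) + 1) ≤ 1 := by rw [div_le_one (by linarith)]; linarith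
      linarith) k
  have hlow : (2 * 𝔡 - k : ℝ) / (2 * 𝔡) ≤ 1 + k * -(2 / (4 * (𝔡 : ℝ) + 1)) := by
    have e1 : (2 * 𝔡 - k : ℝ) / (2 * 𝔡) = 1 - k * (1 / (2 * 𝔡)) := by field_simp
    have e2 : 2 / (4 * (𝔡 : ℝ) + 1) ≤ 1 / (2 * 𝔡) := by
      rw [div_le_div_iff₀ (by linarith) (by linarith)]; linarith
    rw [e1]
    nlinarith [(Nat.cast_nonneg k : (0 : ℝ) ≤ k)]
  rw [e, inv_pow, ← inv_div (2 * (𝔡 : ℝ) - k)]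
  exact inv_anti₀ (div_pos (by linarith) (by linarith)) (hlow.trans hB)

/-- Absence of zeros, and control of the ratios: for complex couplings of modulus at most `R`, a
term with fewer than `𝔡` neighbours in `S` changes the partition function relatively by at most
`1 / (4𝔡)`. The bound holds for all site weights at once, which is what makes the induction on `S`
work. -/
lemma partition_ne_zero_and_ratio {𝔡 : ℕ} (h𝔡 : 1 ≤ 𝔡) (hdeg : ∀ a, (H.nbrs a).card ≤ 𝔡)
    {R : ℝ} (hR : Real.exp R - 1 ≤ 1 / (4 * 𝔡 ^ 2)) {b : M → ℂ} (hb : ∀ a, ‖b a‖ ≤ R)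
    (S : Finset M) : ∀ w : V → Fin q → ℝ, IsSiteProb w → H.partition w b S ≠ 0 ∧
      ∀ a ∈ S, ‖H.partition w b S - H.partition w b (S.erase a)‖ ≤
          1 / 2 * ‖H.partition w b (S.erase a)‖ ∧
        ((H.nbrs a ∩ S).card ≤ 𝔡 - 1 →
          ‖H.partition w b S - H.partition w b (S.erase a)‖ ≤
            1 / (4 * 𝔡) * ‖H.partition w b (S.erase a)‖) := by
  have hd : (1 : ℝ) ≤ 𝔡 := by exact_mod_cast h𝔡
  induction S using Finset.strongInduction with
  | H S ih =>
  intro w hw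
  have hratio : ∀ a ∈ S, ‖H.partition w b S - H.partition w b (S.erase a)‖ ≤
          1 / 2 * ‖H.partition w b (S.erase a)‖ ∧
        ((H.nbrs a ∩ S).card ≤ 𝔡 - 1 →
          ‖H.partition w b S - H.partition w b (S.erase a)‖ ≤
            1 / (4 * 𝔡) * ‖H.partition w b (S.erase a)‖) := by
    intro a ha
    have hδ1 : 1 / (4 * (𝔡 : ℝ)) < 1 := by rw [div_lt_one (by linarith)]; linarith
    have hself : a ∉ H.nbrs a := by simp [nbrs]
    have hinter : H.nbrs a ∩ S.erase a = H.nbrs a ∩ S := by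
      ext c
      simp only [mem_inter, mem_erase]
      exact ⟨fun h => ⟨h.1, h.2.2⟩, fun h => ⟨h.1, fun e => hself (e ▸ h.1), h.2⟩⟩
    -- A neighbour of `a` has lost one of its at most `𝔡` neighbours in `S.erase a`.
    have hlost : ∀ c ∈ H.nbrs a ∩ S.erase a, (H.nbrs c ∩ S.erase a).card ≤ 𝔡 - 1 := by
      intro c hc
      have hac : a ∈ H.nbrs c := by
        have := (mem_inter.1 hc).1
        simp only [nbrs, mem_filter, mem_univ, true_and] at this ⊢
        exact this.symm
      calc (H.nbrs c ∩ S.erase a).card ≤ ((H.nbrs c).erase a).card := by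
            refine card_le_card fun x hx => ?_
            simp only [mem_inter, mem_erase] at hx ⊢
            exact ⟨hx.2.1, hx.1⟩
        _ = (H.nbrs c).card - 1 := card_erase_of_mem hac
        _ ≤ 𝔡 - 1 := Nat.sub_le_sub_right (hdeg c) 1
    have main : ∀ k, (H.nbrs a ∩ S).card ≤ k →
        ‖H.partition w b S - H.partition w b (S.erase a)‖ ≤ (1 / (4 * 𝔡 ^ 2)) *
          ((1 + 1 / (4 * (𝔡 : ℝ))) / (1 - 1 / (4 * (𝔡 : ℝ)))) ^ k *
            ‖H.partition w b (S.erase a)‖ := by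
      intro k hk
      have := H.norm_partition_insert_sub_le (b := b) (ε := 1 / (4 * 𝔡 ^ 2))
        (δ := 1 / (4 * 𝔡)) (k := k) (a := a) (S := S.erase a) (by positivity) hδ1
        (fun s => (H.norm_exp_mul_term_sub_one_le (hb a) a s).trans hR) (notMem_erase a S)
        (by rwa [hinter])
        (fun u hu => H.norm_partition_sdiff_bounds hδ1.le
          (fun S' hS' c hc hcard =>
            ((ih S' (lt_of_le_of_lt hS' (erase_ssubset ha)) u hu).2 c hc).2 hcard)
          inter_subset_right hlost) hw
      rwa [insert_erase ha] at this
    constructor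
    · refine (main 𝔡 ((card_le_card inter_subset_left).trans (hdeg a))).trans ?_
      gcongr
      calc _ ≤ 1 / (4 * (𝔡 : ℝ) ^ 2) * (2 * 𝔡 / (2 * 𝔡 - 𝔡)) := by
            gcongr
            exact growth_factor_le h𝔡 le_rfl
        _ = 1 / (2 * (𝔡 : ℝ) ^ 2) := by
            have : (2 * 𝔡 - 𝔡 : ℝ) = 𝔡 := by ring
            rw [this]
            field_simp
            norm_num
        _ ≤ 1 / 2 := one_div_le_one_div_of_le (by norm_num) (by nlinarith)
    · intro hcard
      refine (main _ hcard).trans ?_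
      gcongr
      calc _ ≤ 1 / (4 * (𝔡 : ℝ) ^ 2) * (2 * 𝔡 / (2 * 𝔡 - (𝔡 - 1 : ℕ))) := by
            gcongr
            exact growth_factor_le h𝔡 (Nat.sub_le _ _)
        _ ≤ 1 / (4 * (𝔡 : ℝ) ^ 2) * 𝔡 := by
            gcongr
            rw [Nat.cast_sub h𝔡, Nat.cast_one, div_le_iff₀ (by linarith)]
            nlinarith
        _ = 1 / (4 * 𝔡) := by field_simp
  refine ⟨?_, hratio⟩
  rcases S.eq_empty_or_nonempty with rfl | ⟨a, ha⟩
  · simp [H.partition_empty hw]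
  · intro h0
    have h1 := (hratio a ha).1
    have h2 := norm_pos_iff.2 (ih _ (erase_ssubset ha) w hw).1
    rw [h0, zero_sub, norm_neg] at h1
    linarith

end DiagHamiltonian

/-! ### Order of vanishing at the origin -/

open Asymptotics Topology in
/-- An exponential sum whose moments of order less than `n` vanish is of order `n` at the origin. -/
lemma isBigO_sum_mul_exp {ι : Type*} (s : Finset ι) (c e : ι → ℂ) (n : ℕ)
    (h : ∀ k < n, ∑ j ∈ s, c j * e j ^ k = 0) :
    (fun ζ : ℂ => ∑ j ∈ s, c j * Complex.exp (ζ * e j)) =O[𝓝 0] fun ζ => ζ ^ n := by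
  -- The Taylor polynomials of degree less than `n` may be subtracted.
  have hrw : (fun ζ : ℂ => ∑ j ∈ s, c j * Complex.exp (ζ * e j)) = fun ζ => ∑ j ∈ s, c j *
      (Complex.exp (ζ * e j) - ∑ m ∈ range n, (ζ * e j) ^ m / m.factorial) := by
    funext ζ
    have h0 : ∑ j ∈ s, c j * ∑ m ∈ range n, (ζ * e j) ^ m / m.factorial = 0 := by
      simp only [mul_sum]
      rw [sum_comm]
      refine sum_eq_zero fun m hm => ?_
      calc _ = ζ ^ m / m.factorial * ∑ j ∈ s, c j * e j ^ m := by
            rw [mul_sum]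
            exact sum_congr rfl fun j _ => by rw [mul_pow]; ring
        _ = 0 := by rw [h m (mem_range.1 hm), mul_zero]
    simp only [mul_sub, sum_sub_distrib, h0, sub_zero]
  rw [hrw]
  refine IsBigO.fun_sum fun j _ => ?_
  refine IsBigO.const_mul_left ?_ (c j)
  refine IsBigO.of_bound (‖e j‖ ^ n * Real.exp ‖e j‖) ?_
  filter_upwards [Metric.closedBall_mem_nhds (0 : ℂ) one_pos] with ζ hζ
  rw [mem_closedBall_zero_iff] at hζ
  calc _ ≤ ‖ζ * e j‖ ^ n * Real.exp ‖ζ * e j‖ :=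
        Complex.norm_exp_sub_sum_le_norm_mul_exp _ n
    _ ≤ (‖ζ‖ * ‖e j‖) ^ n * Real.exp ‖e j‖ := by
        rw [norm_mul]
        gcongr
        exact mul_le_of_le_one_left (norm_nonneg _) hζ
    _ = _ := by rw [norm_pow, mul_pow]; ring

open Asymptotics Topology Filter in
/-- If `g` vanishes continuously at the origin then `g` has at least the order of `exp g - 1`. -/
lemma isBigO_of_exp_sub_one_isBigO {g : ℂ → ℂ} {n : ℕ} (hg : ContinuousAt g 0) (h0 : g 0 = 0)
    (h : (fun ζ => Complex.exp (g ζ) - 1) =O[𝓝 0] fun ζ : ℂ => ζ ^ n) :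
    g =O[𝓝 0] fun ζ => ζ ^ n := by
  refine IsBigO.trans (IsBigO.of_bound 2 ?_) h
  have hmem : ∀ᶠ ζ in 𝓝 0, g ζ ∈ Metric.closedBall (0 : ℂ) (1 / 2) :=
    hg (by rw [h0]; exact Metric.closedBall_mem_nhds _ (by norm_num))
  filter_upwards [hmem] with ζ hζ
  rw [mem_closedBall_zero_iff] at hζ
  have h1 := Complex.norm_exp_sub_one_sub_id_le (x := g ζ) (by linarith)
  have h2 := norm_sub_norm_le (g ζ) (Complex.exp (g ζ) - 1)
  rw [norm_sub_rev (g ζ) (Complex.exp (g ζ) - 1)] at h2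
  nlinarith [norm_nonneg (g ζ)]

open Asymptotics Topology in
/-- The Schwarz lemma for a function that vanishes to order `n` at the origin. -/
lemma norm_le_mul_pow_of_isBigO {g : ℂ → ℂ} {ρ C : ℝ} {n : ℕ}
    (hd : DifferentiableOn ℂ g (Metric.ball 0 ρ)) (hC : ∀ ζ ∈ Metric.ball (0 : ℂ) ρ, ‖g ζ‖ ≤ C)
    (h0 : g 0 = 0) (hn : g =O[𝓝 0] fun ζ => ζ ^ n) {z : ℂ} (hz : z ∈ Metric.ball 0 ρ) :
    ‖g z‖ ≤ C * (‖z‖ / ρ) ^ n := by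
  cases n with
  | zero => simpa using hC z hz
  | succ m =>
    have hlit : (fun ζ => g ζ - g 0) =o[𝓝 0] fun ζ : ℂ => ‖ζ - 0‖ ^ m := by
      simp only [h0, sub_zero]
      have h1 : (fun ζ : ℂ => ζ ^ (m + 1)) =o[𝓝 0] fun ζ : ℂ => ζ ^ m :=
        isLittleO_pow_pow (Nat.lt_succ_self m)
      have h2 := (hn.trans_isLittleO h1).norm_right
      simpa only [norm_pow] using h2
    have := Complex.dist_le_mul_div_pow_of_mapsTo_ball_of_isLittleO (R₂ := C) hd
      (fun ζ hζ => by rw [h0, mem_closedBall_zero_iff]; exact hC ζ hζ) hlit hz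
    simpa [h0] using this

/-! ### Decay of the mixed second difference of the free energy -/

namespace DiagHamiltonian

variable {V M : Type*} [Fintype V] {q : ℕ} (H : DiagHamiltonian V M q)

lemma term_add_term_swapOutside {A : Finset V} {a : M}
    (ha : H.supp a ⊆ A ∨ Disjoint (H.supp a) A) (p : Config V q × Config V q) :
    H.term a (swapOutside A p).1 + H.term a (swapOutside A p).2 =
      H.term a p.1 + H.term a p.2 := by
  rcases ha with ha | ha
  · rw [H.term_congr (s := (swapOutside A p).1) (s' := p.1),
      H.term_congr (s := (swapOutside A p).2) (s' := p.2)] <;>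
    · intro i hi
      simp [swapOutside, ha hi]
  · rw [H.term_congr (s := (swapOutside A p).1) (s' := p.2),
      H.term_congr (s := (swapOutside A p).2) (s' := p.1), add_comm] <;>
    · intro i hi
      simp [swapOutside, disjoint_left.1 ha hi]

lemma partition_mul_partition (w w' : V → Fin q → ℝ) (b : M → ℂ) (S : Finset M) :
    H.partition w b S * H.partition w' b S = ∑ p : Config V q × Config V q,
      ((weight w p.1 * weight w' p.2 : ℝ) : ℂ) *
        Complex.exp (∑ a ∈ S, b a * (H.term a p.1 + H.term a p.2)) := by
  rw [partition, partition, sum_mul_sum, Fintype.sum_prod_type]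
  refine sum_congr rfl fun s _ => sum_congr rfl fun t _ => ?_
  simp only [mul_add, sum_add_distrib, Complex.exp_add]
  push_cast
  ring

/-- If no connected cluster formed by the terms in `S` connects `X` and `Z`, then `X`, together with
the supports of the terms that are connected to `X` within `S`, separates `X` from `Z`. -/
lemma exists_separating_set {X Z : Finset V} (hXZ : Disjoint X Z) (S : Finset M)
    (hS : ∀ W ⊆ S, H.IsConnectedCluster W.val → ¬ H.ClusterConnects W.val X Z) :
    ∃ A, X ⊆ A ∧ Disjoint Z A ∧ ∀ a ∈ S, H.supp a ⊆ A ∨ Disjoint (H.supp a) A := by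
  let C : Finset M := S.filter fun a => ∃ W ⊆ S, H.IsConnectedCluster W.val ∧ a ∈ W ∧
    ∃ a₀ ∈ W, (H.supp a₀ ∩ X).Nonempty
  refine ⟨X ∪ C.biUnion H.supp, subset_union_left, ?_, fun a ha => ?_⟩
  · rw [disjoint_union_right]
    refine ⟨hXZ.symm, (disjoint_biUnion_right _ _ _).2 fun a ha => ?_⟩
    obtain ⟨-, W, hWS, hW, haW, a₀, ha₀, hX⟩ := mem_filter.1 ha
    by_contra hd
    refine hS W hWS hW ⟨⟨a₀, ha₀, hX⟩, a, haW, ?_⟩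
    rwa [inter_comm, ← not_disjoint_iff_nonempty_inter]
  · by_cases haC : a ∈ C
    · exact Or.inl ((subset_biUnion_of_mem H.supp haC).trans subset_union_right)
    · right
      rw [disjoint_union_right]
      constructor
      · by_contra hd
        rw [not_disjoint_iff_nonempty_inter] at hd
        refine haC (mem_filter.2 ⟨ha, {a}, singleton_subset_iff.2 ha, ?_, mem_singleton_self a,
          a, mem_singleton_self a, hd⟩)
        have : {x : M | x ∈ ({a} : Finset M).val} = {a} := by ext; simp
        rw [IsConnectedCluster, this]
        exact SimpleGraph.Connected.of_subsingleton
      · refine (disjoint_biUnion_right _ _ _).2 fun c hc => ?_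
        by_contra hd
        rw [not_disjoint_iff_nonempty_inter] at hd
        obtain ⟨-, W, hWS, hW, hcW, a₀, ha₀, hX⟩ := mem_filter.1 hc
        have hne : c ≠ a := fun h => haC (h ▸ hc)
        refine haC (mem_filter.2 ⟨ha, insert a W, insert_subset ha hWS, ?_,
          mem_insert_self a W, a₀, mem_insert_of_mem ha₀, hX⟩)
        have : {x : M | x ∈ (insert a W).val} = {x : M | x ∈ W.val} ∪ {a} := by
          ext x
          simp only [Set.mem_ofPred_eq, mem_val, mem_insert, Set.mem_union, Set.mem_singleton_iff]
          tauto
        rw [IsConnectedCluster, this]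
        refine SimpleGraph.connected_induce_union (v := c) (w := a) hW.preconnected
          SimpleGraph.Preconnected.of_subsingleton hcW rfl ?_
        exact ⟨hne, by rwa [inter_comm]⟩

/-- Without the terms on the boundary of `X`, the set `X` is decoupled from its complement. -/
lemma partition_sdiff_boundary {w₁ w₀ : V → Fin q → ℝ} {X Z : Finset V}
    (hw : ∀ i, i ∉ X → i ∉ Z → w₁ i = w₀ i) (hXZ : Disjoint X Z) (b : M → ℂ) {S : Finset M}
    (hS : ∀ a ∈ S, ¬ ((∃ i ∈ H.supp a, i ∈ X) ∧ ∃ i ∈ H.supp a, i ∉ X)) :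
    H.partition w₁ b S * H.partition w₀ b S =
      H.partition (X.piecewise w₁ w₀) b S * H.partition (X.piecewise w₀ w₁) b S := by
  rw [partition_mul_partition, partition_mul_partition]
  refine sum_weight_mul_weight_piecewise (F := fun p => Complex.exp
    (∑ a ∈ S, b a * (H.term a p.1 + H.term a p.2))) hw (Subset.refl X) hXZ.symm fun p => ?_
  congr 1
  refine sum_congr rfl fun a ha => ?_
  have hsep : H.supp a ⊆ X ∨ Disjoint (H.supp a) X := by
    by_contra! h
    exact hS a ha ⟨not_disjoint_iff.1 h.2, not_subset.1 h.1⟩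
  have := H.term_add_term_swapOutside hsep p
  rw [← Complex.ofReal_add, this, Complex.ofReal_add]

lemma differentiable_partition (w : V → Fin q → ℝ) (c : M → ℝ) (S : Finset M) :
    Differentiable ℂ fun ζ : ℂ => H.partition w (fun a => ζ * c a) S := by
  unfold partition
  fun_prop

variable [Fintype M]

/-- Fewer terms than `clusterDist X Z` cannot distinguish the two ways of distributing the weights
on `X` and `Z` over two independent copies of the system: the moments of the total energy of the
two copies agree. -/
lemma moments_eq {w₁ w₀ : V → Fin q → ℝ} {X Z : Finset V}
    (hw : ∀ i, i ∉ X → i ∉ Z → w₁ i = w₀ i) (hXZ : Disjoint X Z) (c : M → ℝ) {k : ℕ}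
    (hk : (k : ℕ∞) < H.clusterDist X Z) :
    ∑ p : Config V q × Config V q, ((weight w₁ p.1 * weight w₀ p.2 : ℝ) : ℂ) *
        (∑ a, (c a : ℂ) * (H.term a p.1 + H.term a p.2)) ^ k =
      ∑ p : Config V q × Config V q,
        ((weight (X.piecewise w₁ w₀) p.1 * weight (X.piecewise w₀ w₁) p.2 : ℝ) : ℂ) *
          (∑ a, (c a : ℂ) * (H.term a p.1 + H.term a p.2)) ^ k := by
  -- After expanding the power, each product involves at most `k` distinct terms.
  simp only [Fintype.sum_pow, mul_sum]
  rw [sum_comm, sum_comm (s := (univ : Finset (Config V q × Config V q)))]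
  refine sum_congr rfl fun f _ => ?_
  obtain ⟨A, hXA, hZA, hA⟩ := H.exists_separating_set hXZ (univ.image f) (by
    intro W hW hconn hXZ'
    have h1 : H.clusterDist X Z ≤ (W.val.card : ℕ∞) := iInf₂_le W.val ⟨hconn, hXZ'⟩
    have h2 : W.val.card ≤ k := by
      calc W.card ≤ (univ.image f).card := card_le_card hW
        _ ≤ (univ : Finset (Fin k)).card := card_image_le
        _ = k := by simp
    exact absurd (hk.trans_le h1) (not_lt.2 (by exact_mod_cast h2)))
  refine sum_weight_mul_weight_piecewise (F := fun p =>
    ∏ j, ((c (f j) : ℂ) * (H.term (f j) p.1 + H.term (f j) p.2))) hw hXA hZA fun p => ?_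
  refine prod_congr rfl fun j _ => ?_
  have := H.term_add_term_swapOutside (hA (f j) (mem_image_of_mem f (mem_univ j))) p
  rw [← Complex.ofReal_add, this, Complex.ofReal_add]

/-- The logarithm of the relative change of the partition function upon adding the terms in `B`,
as the sum of the principal logarithms of the ratios for single terms. It is analytic in the scale
of the couplings, and bounded by a multiple of the number of terms. -/
lemma exists_log_ratio {𝔡 : ℕ} (h𝔡 : 1 ≤ 𝔡) (hdeg : ∀ a, (H.nbrs a).card ≤ 𝔡)
    {R ρ : ℝ} (hR : Real.exp R - 1 ≤ 1 / (4 * 𝔡 ^ 2)) {c : M → ℝ} (hc : ∀ a, ρ * |c a| ≤ R)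
    {w : V → Fin q → ℝ} (hw : IsSiteProb w) (B : Finset M) :
    ∃ g : ℂ → ℂ, DifferentiableOn ℂ g (Metric.ball 0 ρ) ∧ g 0 = 0 ∧
      ∀ ζ ∈ Metric.ball (0 : ℂ) ρ, ‖g ζ‖ ≤ 3 / 4 * B.card ∧
        H.partition w (fun a => ζ * c a) univ =
          Complex.exp (g ζ) * H.partition w (fun a => ζ * c a) (univ \ B) := by
  induction B using Finset.induction_on with
  | empty => exact ⟨fun _ => 0, differentiableOn_const _, rfl, fun ζ _ => by simp⟩
  | insert a B ha ih =>
    obtain ⟨g, hgd, hg0, hg⟩ := ih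
    have he : (univ \ B).erase a = univ \ insert a B := by
      ext x; simp only [mem_erase, mem_sdiff, mem_insert]; tauto
    set Z := fun ζ : ℂ => H.partition w (fun a => ζ * c a) (univ \ B) with hZ
    set Z' := fun ζ : ℂ => H.partition w (fun a => ζ * c a) (univ \ insert a B) with hZ'
    have hcoup : ∀ ζ ∈ Metric.ball (0 : ℂ) ρ, ∀ a, ‖ζ * (c a : ℂ)‖ ≤ R := by
      intro ζ hζ a
      rw [mem_ball_zero_iff] at hζ
      rw [norm_mul, Complex.norm_real, Real.norm_eq_abs]
      exact (mul_le_mul_of_nonneg_right hζ.le (abs_nonneg _)).trans (hc a)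
    have hne : ∀ ζ ∈ Metric.ball (0 : ℂ) ρ, Z' ζ ≠ 0 := fun ζ hζ =>
      (H.partition_ne_zero_and_ratio h𝔡 hdeg hR (hcoup ζ hζ) (univ \ insert a B) w hw).1
    have hne1 : ∀ ζ ∈ Metric.ball (0 : ℂ) ρ, Z ζ ≠ 0 := fun ζ hζ =>
      (H.partition_ne_zero_and_ratio h𝔡 hdeg hR (hcoup ζ hζ) (univ \ B) w hw).1
    have hhalf : ∀ ζ ∈ Metric.ball (0 : ℂ) ρ, ‖(Z ζ - Z' ζ) / Z' ζ‖ ≤ 1 / 2 := by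
      intro ζ hζ
      have := ((H.partition_ne_zero_and_ratio h𝔡 hdeg hR (hcoup ζ hζ) (univ \ B) w hw).2 a
        (by simp [ha])).1
      rw [he] at this
      rw [norm_div, div_le_iff₀ (norm_pos_iff.2 (hne ζ hζ))]
      exact this
    have hone : ∀ ζ ∈ Metric.ball (0 : ℂ) ρ, 1 + (Z ζ - Z' ζ) / Z' ζ = Z ζ / Z' ζ := by
      intro ζ hζ
      have := hne ζ hζ
      field_simp
      ring
    refine ⟨fun ζ => g ζ + Complex.log (1 + (Z ζ - Z' ζ) / Z' ζ), ?_, ?_, fun ζ hζ => ⟨?_, ?_⟩⟩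
    · refine hgd.add (DifferentiableOn.clog ?_ ?_)
      · exact (((H.differentiable_partition w c _).differentiableOn.sub
          (H.differentiable_partition w c _).differentiableOn).div
          (H.differentiable_partition w c _).differentiableOn hne).const_add 1
      · intro ζ hζ
        refine Complex.mem_slitPlane_of_norm_lt_one ?_
        linarith [hhalf ζ hζ]
    · have : Z 0 - Z' 0 = 0 := by simp [hZ, hZ', partition]
      simp [hg0, this]
    · rw [card_insert_of_notMem ha]
      have h1 := Complex.norm_log_one_add_half_le_self (hhalf ζ hζ)
      have h2 := hhalf ζ hζ
      have h3 := (hg ζ hζ).1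
      have h4 := norm_add_le (g ζ) (Complex.log (1 + (Z ζ - Z' ζ) / Z' ζ))
      push_cast
      linarith
    · rw [(hg ζ hζ).2, Complex.exp_add, hone ζ hζ,
        Complex.exp_log (div_ne_zero (hne1 ζ hζ) (hne ζ hζ)), mul_assoc,
        div_mul_cancel₀ _ (hne ζ hζ)]

open Asymptotics Topology in
/-- The mixed second difference of the free energy, with respect to changing the site weights on
`X` and on `Z`, decays exponentially with the cluster distance of `X` and `Z`. As a function of the
scale `ζ` of the couplings it vanishes to order `clusterDist X Z` at the origin, and it is at most
`3|∂X|` in the disc of radius `ρ`, so the Schwarz lemma applies. -/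
lemma abs_log_partition_ratio_le {𝔡 : ℕ} (h𝔡 : 1 ≤ 𝔡) (hdeg : ∀ a, (H.nbrs a).card ≤ 𝔡)
    {R ρ : ℝ} (hR : Real.exp R - 1 ≤ 1 / (4 * 𝔡 ^ 2)) (hρ : 1 < ρ) {c : M → ℝ}
    (hc : ∀ a, ρ * |c a| ≤ R) {w₁ w₀ : V → Fin q → ℝ} (hw₁ : IsSiteProb w₁)
    (hw₀ : IsSiteProb w₀) {X Z : Finset V} (hw : ∀ i, i ∉ X → i ∉ Z → w₁ i = w₀ i)
    (hXZ : Disjoint X Z) {n : ℕ} (hn : (n : ℕ∞) ≤ H.clusterDist X Z) :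
    |Real.log ‖H.partition w₁ (fun a => (c a : ℂ)) univ * H.partition w₀ (fun a => (c a : ℂ)) univ /
      (H.partition (X.piecewise w₁ w₀) (fun a => (c a : ℂ)) univ *
        H.partition (X.piecewise w₀ w₁) (fun a => (c a : ℂ)) univ)‖| ≤
      3 * H.boundarySize X * (1 / ρ) ^ n := by
  set B : Finset M := univ.filter fun a : M =>
    (∃ i ∈ H.supp a, i ∈ X) ∧ ∃ i ∈ H.supp a, i ∉ X with hB
  have hw₁₀ := hw₁.piecewise hw₀ X
  have hw₀₁ := hw₀.piecewise hw₁ X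
  obtain ⟨g₁, hd₁, hz₁, hg₁⟩ := H.exists_log_ratio h𝔡 hdeg hR hc hw₁ B
  obtain ⟨g₂, hd₂, hz₂, hg₂⟩ := H.exists_log_ratio h𝔡 hdeg hR hc hw₀ B
  obtain ⟨g₃, hd₃, hz₃, hg₃⟩ := H.exists_log_ratio h𝔡 hdeg hR hc hw₁₀ B
  obtain ⟨g₄, hd₄, hz₄, hg₄⟩ := H.exists_log_ratio h𝔡 hdeg hR hc hw₀₁ B
  set P := fun (w : V → Fin q → ℝ) (ζ : ℂ) => H.partition w (fun a => ζ * c a) univ with hP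
  have hne : ∀ w, IsSiteProb w → ∀ ζ ∈ Metric.ball (0 : ℂ) ρ, ∀ S,
      H.partition w (fun a => ζ * c a) S ≠ 0 := by
    intro w hw ζ hζ S
    refine (H.partition_ne_zero_and_ratio h𝔡 hdeg hR (fun a => ?_) S w hw).1
    rw [mem_ball_zero_iff] at hζ
    rw [norm_mul, Complex.norm_real, Real.norm_eq_abs]
    exact (mul_le_mul_of_nonneg_right hζ.le (abs_nonneg _)).trans (hc a)
  set G : ℂ → ℂ := fun ζ => g₁ ζ + g₂ ζ - (g₃ ζ + g₄ ζ) with hG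
  have hGd : DifferentiableOn ℂ G (Metric.ball 0 ρ) := (hd₁.add hd₂).sub (hd₃.add hd₄)
  have hG0 : G 0 = 0 := by simp [hG, hz₁, hz₂, hz₃, hz₄]
  have hGC : ∀ ζ ∈ Metric.ball (0 : ℂ) ρ, ‖G ζ‖ ≤ 3 * H.boundarySize X := by
    intro ζ hζ
    have hcard : H.boundarySize X = B.card := rfl
    have h5 := norm_sub_le (g₁ ζ + g₂ ζ) (g₃ ζ + g₄ ζ)
    have h6 := norm_add_le (g₁ ζ) (g₂ ζ)
    have h7 := norm_add_le (g₃ ζ) (g₄ ζ)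
    rw [hcard]
    linarith [(hg₁ ζ hζ).1, (hg₂ ζ hζ).1, (hg₃ ζ hζ).1, (hg₄ ζ hζ).1]
  -- The free energies without the boundary terms cancel.
  have hGexp : ∀ ζ ∈ Metric.ball (0 : ℂ) ρ, Complex.exp (G ζ) =
      P w₁ ζ * P w₀ ζ / (P (X.piecewise w₁ w₀) ζ * P (X.piecewise w₀ w₁) ζ) := by
    intro ζ hζ
    have hcut := H.partition_sdiff_boundary hw hXZ (fun a => ζ * c a) (S := univ \ B)
      (fun a ha => by simpa [hB] using ha)
    have n3 := hne _ hw₁₀ ζ hζ (univ \ B)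
    have n4 := hne _ hw₀₁ ζ hζ (univ \ B)
    rw [eq_div_iff (mul_ne_zero (hne _ hw₁₀ ζ hζ univ) (hne _ hw₀₁ ζ hζ univ))]
    simp only [hP]
    rw [(hg₁ ζ hζ).2, (hg₂ ζ hζ).2, (hg₃ ζ hζ).2, (hg₄ ζ hζ).2]
    have hsplit : Complex.exp (g₁ ζ) * Complex.exp (g₂ ζ) =
        Complex.exp (G ζ) * (Complex.exp (g₃ ζ) * Complex.exp (g₄ ζ)) := by
      rw [← Complex.exp_add, ← Complex.exp_add, ← Complex.exp_add]
      congr 1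
      simp only [hG]
      ring
    linear_combination (-H.partition w₁ (fun a => ζ * ↑(c a)) (univ \ B) *
      H.partition w₀ (fun a => ζ * ↑(c a)) (univ \ B)) * hsplit -
      (Complex.exp (G ζ) * (Complex.exp (g₃ ζ) * Complex.exp (g₄ ζ))) * hcut
  have h0mem : (0 : ℂ) ∈ Metric.ball (0 : ℂ) ρ := by
    rw [mem_ball_zero_iff, norm_zero]; linarith
  have hΔ : (fun ζ => P w₁ ζ * P w₀ ζ - P (X.piecewise w₁ w₀) ζ * P (X.piecewise w₀ w₁) ζ)
      =O[𝓝 0] fun ζ : ℂ => ζ ^ n := by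
    have := isBigO_sum_mul_exp (univ : Finset (Config V q × Config V q))
      (fun p => ((weight w₁ p.1 * weight w₀ p.2 : ℝ) : ℂ) -
        ((weight (X.piecewise w₁ w₀) p.1 * weight (X.piecewise w₀ w₁) p.2 : ℝ) : ℂ))
      (fun p => ∑ a, (c a : ℂ) * (H.term a p.1 + H.term a p.2)) n (fun k hk => by
        simp only [sub_mul, sum_sub_distrib]
        rw [H.moments_eq hw hXZ c (lt_of_lt_of_le (by exact_mod_cast hk) hn), sub_self])
    refine this.congr_left fun ζ => ?_
    simp only [hP, partition_mul_partition, sub_mul, sum_sub_distrib, mul_sum, mul_assoc]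
  have hGO : G =O[𝓝 0] fun ζ => ζ ^ n := by
    have hball := Metric.ball_mem_nhds (0 : ℂ) (by linarith : (0 : ℝ) < ρ)
    refine isBigO_of_exp_sub_one_isBigO (hGd.continuousOn.continuousAt hball) hG0 ?_
    set D := fun ζ => P (X.piecewise w₁ w₀) ζ * P (X.piecewise w₀ w₁) ζ with hD
    have hDc : ContinuousAt (fun ζ => (D ζ)⁻¹) 0 :=
      (((H.differentiable_partition _ c _).continuous.mul
        (H.differentiable_partition _ c _).continuous).continuousAt).inv₀
        (mul_ne_zero (hne _ hw₁₀ 0 h0mem univ) (hne _ hw₀₁ 0 h0mem univ))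
    have h1 : (fun ζ => (D ζ)⁻¹) =O[𝓝 0] fun _ : ℂ => (1 : ℂ) := hDc.isBigO_one ℂ
    have h2 := hΔ.mul h1
    simp only [mul_one] at h2
    refine h2.congr' ?_ Filter.EventuallyEq.rfl
    filter_upwards [hball] with ζ hζ
    have : D ζ ≠ 0 := mul_ne_zero (hne _ hw₁₀ ζ hζ univ) (hne _ hw₀₁ ζ hζ univ)
    rw [hGexp ζ hζ]
    change (P w₁ ζ * P w₀ ζ - D ζ) * (D ζ)⁻¹ = P w₁ ζ * P w₀ ζ / D ζ - 1
    field_simp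
  have h1mem : (1 : ℂ) ∈ Metric.ball (0 : ℂ) ρ := by
    rw [mem_ball_zero_iff, norm_one]; exact hρ
  -- The couplings of interest are the value `ζ = 1`.
  have hfin := norm_le_mul_pow_of_isBigO hGd hGC hG0 hGO h1mem
  have hexp := hGexp 1 h1mem
  simp only [hP, one_mul] at hexp
  rw [← hexp, Complex.norm_exp, Real.log_exp]
  rw [norm_one] at hfin
  exact (Complex.abs_re_le_norm _).trans hfin

end DiagHamiltonian

/-! ### Entropies and marginals of the transformed distribution -/

section Information

variable {V : Type*} {q : ℕ}

/-- The matrix by which `applyTransition T Y` acts on the site `i`. -/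
def siteMatrix (T : V → Matrix (Fin q) (Fin q) ℝ) (Y : Finset V) (i : V) :
    Matrix (Fin q) (Fin q) ℝ := if i ∈ Y then T i else 1

lemma siteMatrix_mem {T : V → Matrix (Fin q) (Fin q) ℝ} {Y : Finset V}
    (hT : ∀ i ∈ Y, T i ∈ Matrix.colStochastic ℝ (Fin q)) (i : V) :
    siteMatrix T Y i ∈ Matrix.colStochastic ℝ (Fin q) := by
  by_cases h : i ∈ Y
  · simpa [siteMatrix, h] using hT i h
  · simp [siteMatrix, h]

lemma sum_siteMatrix_pos {T : V → Matrix (Fin q) (Fin q) ℝ} {Y : Finset V}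
    (hT : ∀ i ∈ Y, T i ∈ Matrix.colStochastic ℝ (Fin q)) (hT0 : ∀ i ∈ Y, ∀ x x', T i x x' ≠ 0)
    (i : V) (x : Fin q) : 0 < ∑ x', siteMatrix T Y i x x' := by
  refine sum_pos' (fun x' _ => Matrix.nonneg_of_mem_colStochastic (siteMatrix_mem hT i))
    ⟨x, mem_univ x, ?_⟩
  refine lt_of_le_of_ne (Matrix.nonneg_of_mem_colStochastic (siteMatrix_mem hT i)) (Ne.symm ?_)
  by_cases h : i ∈ Y
  · simpa [siteMatrix, h] using hT0 i h x x
  · simp [siteMatrix, h]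

/-- The site weights that describe the conditioned state: the rows of the transition matrices,
normalized, on the sites in `L`, and the uniform distribution elsewhere. -/
def condWeights (T : V → Matrix (Fin q) (Fin q) ℝ) (Y : Finset V) (s : Config V q)
    (L : Finset V) : V → Fin q → ℝ :=
  L.piecewise (fun i x => siteMatrix T Y i (s i) x / ∑ x', siteMatrix T Y i (s i) x')
    fun _ _ => 1 / q

lemma isSiteProb_condWeights (hq : 1 ≤ q) {T : V → Matrix (Fin q) (Fin q) ℝ} {Y : Finset V}
    (hT : ∀ i ∈ Y, T i ∈ Matrix.colStochastic ℝ (Fin q)) (hT0 : ∀ i ∈ Y, ∀ x x', T i x x' ≠ 0)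
    (s : Config V q) (L : Finset V) : IsSiteProb (condWeights T Y s L) := by
  refine IsSiteProb.piecewise ⟨fun i x => ?_, fun i => ?_⟩ ⟨fun i x => by positivity, fun i => ?_⟩ L
  · exact div_nonneg (Matrix.nonneg_of_mem_colStochastic (siteMatrix_mem hT i))
      (sum_siteMatrix_pos hT hT0 i _).le
  · rw [← sum_div, div_self (sum_siteMatrix_pos hT hT0 i _).ne']
  · have : (q : ℝ) ≠ 0 := by exact_mod_cast (by omega : q ≠ 0)
    simp [this]

variable [Fintype V]

lemma applyTransition_eq (T : V → Matrix (Fin q) (Fin q) ℝ) (Y : Finset V) (P : Config V q → ℝ)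
    (s : Config V q) :
    applyTransition T Y P s = ∑ s', (∏ i, siteMatrix T Y i (s i) (s' i)) * P s' := rfl

lemma entropy_eq_neg_sum (P : Config V q → ℝ) (L : Finset V) :
    entropy P L = -∑ s, P s * Real.log (marginal P L fun i : L => s i) := by
  have h : ∀ u : L → Fin q, Real.negMulLog (marginal P L u) =
      -∑ s : Config V q, if (fun i : L => s i) = u then P s * Real.log (marginal P L u) else 0 := by
    intro u
    rw [Real.negMulLog, neg_mul, neg_inj]
    generalize Real.log (marginal P L u) = l
    rw [marginal, sum_mul]
    refine sum_congr rfl fun s _ => ?_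
    split_ifs <;> simp
  rw [entropy, sum_congr rfl fun u _ => h u, sum_neg_distrib, sum_comm]
  simp

/-- The conditional mutual information is the average of the pointwise one. -/
lemma condMutualInfo_le_of_forall {P : Config V q → ℝ} (hP : ∀ s, 0 ≤ P s) (hP1 : ∑ s, P s = 1)
    (X Z Y : Finset V) {C : ℝ}
    (hC : ∀ s : Config V q,
      Real.log (marginal P Y fun i : Y => s i) +
        Real.log (marginal P (X ∪ Y ∪ Z) fun i : (X ∪ Y ∪ Z : Finset V) => s i) -
        Real.log (marginal P (X ∪ Y) fun i : (X ∪ Y : Finset V) => s i) -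
        Real.log (marginal P (Z ∪ Y) fun i : (Z ∪ Y : Finset V) => s i) ≤ C) :
    condMutualInfo P X Z Y ≤ C := by
  simp only [condMutualInfo, entropy_eq_neg_sum]
  calc _ = ∑ s, P s * (Real.log (marginal P Y fun i : Y => s i) +
        Real.log (marginal P (X ∪ Y ∪ Z) fun i : (X ∪ Y ∪ Z : Finset V) => s i) -
        Real.log (marginal P (X ∪ Y) fun i : (X ∪ Y : Finset V) => s i) -
        Real.log (marginal P (Z ∪ Y) fun i : (Z ∪ Y : Finset V) => s i)) := by
        simp only [mul_sub, mul_add, sum_sub_distrib, sum_add_distrib]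
        ring
    _ ≤ ∑ s, P s * C := sum_le_sum fun s _ => mul_le_mul_of_nonneg_left (hC s) (hP s)
    _ = C := by rw [← sum_mul, hP1, one_mul]

lemma condMutualInfo_comm (P : Config V q → ℝ) (X Z Y : Finset V) :
    condMutualInfo P X Z Y = condMutualInfo P Z X Y := by
  have : X ∪ Y ∪ Z = Z ∪ Y ∪ X := by
    ext i; simp only [mem_union]; tauto
  simp only [condMutualInfo, this]
  ring

/-- Evaluating the marginal on `L` of the image of a distribution conditions the sites in `L` and
ignores the others. -/
lemma marginal_applyTransition {T : V → Matrix (Fin q) (Fin q) ℝ} {Y : Finset V}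
    (hT : ∀ i ∈ Y, T i ∈ Matrix.colStochastic ℝ (Fin q)) (P : Config V q → ℝ) (L : Finset V)
    (s : Config V q) :
    marginal (applyTransition T Y P) L (fun i : L => s i) =
      ∑ s', weight (L.piecewise (fun i => siteMatrix T Y i (s i)) fun _ _ => 1) s' * P s' := by
  have h1 : ∀ t : Config V q,
      (if (fun i : L => t i) = (fun i : L => s i) then applyTransition T Y P t else 0) =
        ∑ s', (∏ i, if i ∈ L → t i = s i then siteMatrix T Y i (t i) (s' i) else 0) * P s' := by
    intro t
    by_cases ht : ∀ i ∈ L, t i = s i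
    · rw [if_pos (funext fun i : L => ht i i.2), applyTransition_eq]
      refine sum_congr rfl fun s' _ => ?_
      congr 1
      exact prod_congr rfl fun i _ => by rw [if_pos (ht i)]
    · rw [if_neg fun h => ht fun i hi => congrFun h ⟨i, hi⟩]
      push Not at ht
      obtain ⟨i, hi, hne⟩ := ht
      symm
      refine sum_eq_zero fun s' _ => ?_
      rw [prod_eq_zero (mem_univ i) (if_neg fun h => hne (h hi)), zero_mul]
  rw [marginal, sum_congr rfl fun t _ => h1 t, sum_comm]
  refine sum_congr rfl fun s' _ => ?_
  rw [← sum_mul, ← Fintype.prod_sum fun i x =>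
    if i ∈ L → x = s i then siteMatrix T Y i x (s' i) else 0]
  congr 1
  refine prod_congr rfl fun i _ => ?_
  by_cases hi : i ∈ L
  · simp [hi]
  · simp [hi, Matrix.sum_col_of_mem_colStochastic (siteMatrix_mem hT i)]

lemma applyTransition_nonneg {T : V → Matrix (Fin q) (Fin q) ℝ} {Y : Finset V}
    (hT : ∀ i ∈ Y, T i ∈ Matrix.colStochastic ℝ (Fin q)) {P : Config V q → ℝ}
    (hP : ∀ s, 0 ≤ P s) (s : Config V q) : 0 ≤ applyTransition T Y P s :=
  sum_nonneg fun s' _ => mul_nonneg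
    (prod_nonneg fun i _ => Matrix.nonneg_of_mem_colStochastic (siteMatrix_mem hT i)) (hP s')

lemma sum_applyTransition {T : V → Matrix (Fin q) (Fin q) ℝ} {Y : Finset V}
    (hT : ∀ i ∈ Y, T i ∈ Matrix.colStochastic ℝ (Fin q)) (P : Config V q → ℝ) :
    ∑ s, applyTransition T Y P s = ∑ s, P s := by
  simp only [applyTransition_eq]
  rw [sum_comm]
  refine sum_congr rfl fun s' _ => ?_
  rw [← sum_mul, ← Fintype.prod_sum fun i x => siteMatrix T Y i x (s' i)]
  rw [prod_eq_one fun i _ => Matrix.sum_col_of_mem_colStochastic (siteMatrix_mem hT i) (i := s' i),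
    one_mul]

end Information

/-! ### The conditional mutual information of the transformed Gibbs distribution -/

namespace DiagHamiltonian

variable {V M : Type*} [Fintype V] {q : ℕ} (H : DiagHamiltonian V M q)

lemma clusterDist_comm (X Z : Finset V) : H.clusterDist X Z = H.clusterDist Z X := by
  have h : ∀ A B : Finset V, ∀ W, H.ClusterConnects W A B → H.ClusterConnects W B A :=
    fun A B W hW => ⟨hW.2, hW.1⟩
  simp only [clusterDist]
  refine iInf_congr fun W => iInf_congr_Prop ?_ fun _ => rfl
  exact and_congr_right fun _ => ⟨h X Z W, h Z X W⟩

variable [Fintype M]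

lemma gibbs_nonneg (β : ℝ) (s : Config V q) : 0 ≤ H.gibbs β s :=
  div_nonneg (Real.exp_nonneg _) (sum_nonneg fun _ _ => Real.exp_nonneg _)

lemma sum_exp_energy_pos (hq : 1 ≤ q) (β : ℝ) :
    0 < ∑ s : Config V q, Real.exp (-β * H.energy s) :=
  sum_pos (fun _ _ => Real.exp_pos _) ⟨fun _ => ⟨0, hq⟩, mem_univ _⟩

lemma sum_gibbs (hq : 1 ≤ q) (β : ℝ) : ∑ s, H.gibbs β s = 1 := by
  simp only [gibbs]
  rw [← sum_div, div_self (H.sum_exp_energy_pos hq β).ne']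

/-- The marginals of the transformed Gibbs distribution are partition functions, up to an explicit
normalization. -/
lemma marginal_gibbs_eq (hq : 1 ≤ q) {T : V → Matrix (Fin q) (Fin q) ℝ} {Y : Finset V}
    (hT : ∀ i ∈ Y, T i ∈ Matrix.colStochastic ℝ (Fin q)) (hT0 : ∀ i ∈ Y, ∀ x x', T i x x' ≠ 0)
    (β : ℝ) (s : Config V q) (L : Finset V) :
    0 < marginal (applyTransition T Y (H.gibbs β)) L (fun i : L => s i) ∧
    marginal (applyTransition T Y (H.gibbs β)) L (fun i : L => s i) =
      (∏ i, if i ∈ L then ∑ x, siteMatrix T Y i (s i) x else (q : ℝ)) *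
        (∑ s', Real.exp (-β * H.energy s'))⁻¹ *
        ‖H.partition (condWeights T Y s L) (fun a => ((-β * H.coeff a : ℝ) : ℂ)) univ‖ := by
  have hq0 : (0 : ℝ) < q := by exact_mod_cast hq
  have hZ := H.sum_exp_energy_pos hq β
  have hw := isSiteProb_condWeights hq hT hT0 s L
  set C : ℝ := ∏ i, if i ∈ L then ∑ x, siteMatrix T Y i (s i) x else (q : ℝ) with hC
  have hCpos : 0 < C := prod_pos fun i _ => by
    split_ifs
    · exact sum_siteMatrix_pos hT hT0 i _
    · exact hq0
  set r : ℝ := ∑ s', weight (condWeights T Y s L) s' * Real.exp (-β * H.energy s') with hr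
  have hpart : H.partition (condWeights T Y s L) (fun a => ((-β * H.coeff a : ℝ) : ℂ)) univ =
      r := by
    rw [partition, hr]
    push_cast
    refine sum_congr rfl fun s' _ => ?_
    congr 2
    rw [energy]
    push_cast
    rw [mul_sum]
    exact sum_congr rfl fun a _ => mul_assoc _ _ _
  have hrpos : 0 < r := by
    obtain ⟨s₀, -, hs₀⟩ : ∃ s₀ ∈ univ, 0 < weight (condWeights T Y s L) s₀ := by
      refine exists_lt_of_sum_lt ?_
      rw [sum_const_zero, hw.sum_weight]
      exact one_pos
    exact sum_pos' (fun s' _ => mul_nonneg (weight_nonneg hw.nonneg s') (Real.exp_nonneg _))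
      ⟨s₀, mem_univ _, mul_pos hs₀ (Real.exp_pos _)⟩
  have heq : marginal (applyTransition T Y (H.gibbs β)) L (fun i : L => s i) =
      C * (∑ s', Real.exp (-β * H.energy s'))⁻¹ * r := by
    rw [marginal_applyTransition hT, hr, mul_sum]
    refine sum_congr rfl fun s' _ => ?_
    have hweight : weight (L.piecewise (fun i => siteMatrix T Y i (s i)) fun _ _ => 1) s' =
        C * weight (condWeights T Y s L) s' := by
      rw [weight, weight, hC, ← prod_mul_distrib]
      refine prod_congr rfl fun i _ => ?_
      by_cases hi : i ∈ L
      · have := (sum_siteMatrix_pos hT hT0 i (s i)).ne'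
        simp only [condWeights, hi, piecewise_eq_of_mem, if_true]
        field_simp
      · simp [condWeights, hi, hq0.ne']
    rw [hweight, gibbs, div_eq_mul_inv]
    ring
  rw [hpart, Complex.norm_real, Real.norm_eq_abs, abs_of_pos hrpos, heq]
  exact ⟨by positivity, rfl⟩

/-- The bound in terms of the boundary of `X`, at any order `n` up to the cluster distance. -/
lemma condMutualInfo_gibbs_le (hq : 1 ≤ q) {𝔡 : ℕ} (h𝔡 : 1 ≤ 𝔡)
    (hdeg : ∀ a, (H.nbrs a).card ≤ 𝔡) {R ρ β : ℝ} (hR : Real.exp R - 1 ≤ 1 / (4 * 𝔡 ^ 2))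
    (hρ : 1 < ρ) (hβ : 0 < β) (hβR : ρ * β ≤ R) {X Y Z : Finset V} (hXY : Disjoint X Y)
    (hXZ : Disjoint X Z) {T : V → Matrix (Fin q) (Fin q) ℝ}
    (hT : ∀ i ∈ Y, T i ∈ Matrix.colStochastic ℝ (Fin q)) (hT0 : ∀ i ∈ Y, ∀ x x', T i x x' ≠ 0)
    {n : ℕ} (hn : (n : ℕ∞) ≤ H.clusterDist X Z) :
    condMutualInfo (applyTransition T Y (H.gibbs β)) X Z Y ≤
      3 * H.boundarySize X * (1 / ρ) ^ n := by
  refine condMutualInfo_le_of_forall (applyTransition_nonneg hT (H.gibbs_nonneg β))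
    (by rw [sum_applyTransition hT, H.sum_gibbs hq]) X Z Y fun s => ?_
  have hw := isSiteProb_condWeights hq hT hT0 s
  have hXYw : X.piecewise (condWeights T Y s (X ∪ Y ∪ Z)) (condWeights T Y s Y) =
      condWeights T Y s (X ∪ Y) := by
    ext i x
    by_cases hX : i ∈ X <;> by_cases hY : i ∈ Y <;> simp [condWeights, hX, hY]
  have hZYw : X.piecewise (condWeights T Y s Y) (condWeights T Y s (X ∪ Y ∪ Z)) =
      condWeights T Y s (Z ∪ Y) := by
    ext i x
    by_cases hX : i ∈ X
    · simp [condWeights, hX, disjoint_left.1 hXY hX, disjoint_left.1 hXZ hX]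
    · by_cases hY : i ∈ Y <;> by_cases hZ : i ∈ Z <;> simp [condWeights, hX, hY, hZ]
  have hc : ∀ a, ρ * |(-β * H.coeff a)| ≤ R := by
    intro a
    rw [abs_mul, abs_neg, abs_of_pos hβ]
    refine le_trans ?_ hβR
    gcongr
    exact mul_le_of_le_one_right hβ.le (H.abs_coeff_le a)
  have hmain := H.abs_log_partition_ratio_le h𝔡 hdeg hR hρ (c := fun a => -β * H.coeff a) hc
    (hw (X ∪ Y ∪ Z)) (hw Y) (X := X) (Z := Z)
    (fun i hX hZ => by by_cases hY : i ∈ Y <;> simp [condWeights, hX, hZ, hY]) hXZ hn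
  rw [hXYw, hZYw] at hmain
  refine le_trans (le_of_eq ?_) ((le_abs_self _).trans hmain)
  obtain ⟨p₁, e₁⟩ := H.marginal_gibbs_eq hq hT hT0 β s (X ∪ Y ∪ Z)
  obtain ⟨p₂, e₂⟩ := H.marginal_gibbs_eq hq hT hT0 β s Y
  obtain ⟨p₃, e₃⟩ := H.marginal_gibbs_eq hq hT hT0 β s (X ∪ Y)
  obtain ⟨p₄, e₄⟩ := H.marginal_gibbs_eq hq hT hT0 β s (Z ∪ Y)
  rw [sub_sub, ← Real.log_mul p₂.ne' p₁.ne', ← Real.log_mul p₃.ne' p₄.ne',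
    ← Real.log_div (mul_pos p₂ p₁).ne' (mul_pos p₃ p₄).ne']
  congr 1
  have hnorm : (∏ i, if i ∈ X ∪ Y ∪ Z then ∑ x, siteMatrix T Y i (s i) x else (q : ℝ)) *
      (∏ i, if i ∈ Y then ∑ x, siteMatrix T Y i (s i) x else (q : ℝ)) =
      (∏ i, if i ∈ X ∪ Y then ∑ x, siteMatrix T Y i (s i) x else (q : ℝ)) *
      ∏ i, if i ∈ Z ∪ Y then ∑ x, siteMatrix T Y i (s i) x else (q : ℝ) := by
    rw [← prod_mul_distrib, ← prod_mul_distrib]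
    refine prod_congr rfl fun i _ => ?_
    by_cases hX : i ∈ X
    · simp [hX, disjoint_left.1 hXY hX, disjoint_left.1 hXZ hX]
    · by_cases hY : i ∈ Y <;> by_cases hZ : i ∈ Z <;> simp [hX, hY, hZ, mul_comm]
  rw [norm_div, norm_mul, norm_mul]
  rw [e₃] at p₃
  rw [e₄] at p₄
  rw [e₁, e₂, e₃, e₄]
  have n₃ := right_ne_zero_of_mul p₃.ne'
  have n₄ := right_ne_zero_of_mul p₄.ne'
  rw [div_eq_div_iff (mul_pos p₃ p₄).ne' (mul_ne_zero n₃ n₄)]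
  generalize ‖H.partition (condWeights T Y s (X ∪ Y ∪ Z)) _ univ‖ = z₁
  generalize ‖H.partition (condWeights T Y s Y) _ univ‖ = z₂
  generalize ‖H.partition (condWeights T Y s (X ∪ Y)) _ univ‖ = z₃
  generalize ‖H.partition (condWeights T Y s (Z ∪ Y)) _ univ‖ = z₄
  linear_combination ((∑ s', Real.exp (-β * H.energy s'))⁻¹ ^ 2 * z₁ * z₂ * z₃ * z₄) * hnorm

end DiagHamiltonian

/-! ### Numerical constants -/

/-- At `K = 2e/5`, the inverse temperature `K β_c` is within the radius `1 / (5𝔡²)` in which the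
partition functions have no zeros. -/
lemma mul_betaC_le {𝔡 : ℕ} (h𝔡 : 1 ≤ 𝔡) :
    2 * Real.exp 1 / 5 * betaC 𝔡 ≤ 1 / (5 * (𝔡 : ℝ) ^ 2) := by
  have hd : (1 : ℝ) ≤ 𝔡 := by exact_mod_cast h𝔡
  have he : (2 : ℝ) ≤ Real.exp 1 := by linarith [Real.exp_one_gt_d9]
  have h1 : (0 : ℝ) < 1 + Real.exp 1 * ((𝔡 : ℝ) - 1) := by nlinarith
  have h2 : 2 * Real.exp 1 / 5 * betaC 𝔡 =
      2 / (5 * (((𝔡 : ℝ) + 1) * (1 + Real.exp 1 * ((𝔡 : ℝ) - 1)))) := by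
    rw [betaC]
    field_simp
  rw [h2, div_le_div_iff₀ (by positivity) (by positivity)]
  have h3 : (0 : ℝ) ≤ 𝔡 + 1 := by linarith
  nlinarith [mul_nonneg (sub_nonneg.2 he) (mul_nonneg (sub_nonneg.2 hd) h3)]

/-- The couplings of modulus at most `1 / (5𝔡²)` satisfy the smallness condition of
`partition_ne_zero_and_ratio`. -/
lemma exp_inv_sub_one_le {𝔡 : ℕ} (h𝔡 : 1 ≤ 𝔡) :
    Real.exp (1 / (5 * (𝔡 : ℝ) ^ 2)) - 1 ≤ 1 / (4 * (𝔡 : ℝ) ^ 2) := by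
  have hd : (1 : ℝ) ≤ 𝔡 := by exact_mod_cast h𝔡
  have hd2 : (1 : ℝ) ≤ (𝔡 : ℝ) ^ 2 := one_le_pow₀ hd
  have h1 : 1 / (5 * (𝔡 : ℝ) ^ 2) < 1 := by rw [div_lt_one (by positivity)]; linarith
  have h2 := Real.exp_bound_div_one_sub_of_interval (by positivity) h1
  have h3 : 1 / (1 - 1 / (5 * (𝔡 : ℝ) ^ 2)) - 1 = 1 / (5 * (𝔡 : ℝ) ^ 2 - 1) := by
    have : (5 * (𝔡 : ℝ) ^ 2 - 1) ≠ 0 := by linarith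
    have h4 : 1 - 1 / (5 * (𝔡 : ℝ) ^ 2) = (5 * (𝔡 : ℝ) ^ 2 - 1) / (5 * (𝔡 : ℝ) ^ 2) := by
      field_simp
    rw [h4, one_div_div]
    field_simp
    ring
  calc _ ≤ 1 / (5 * (𝔡 : ℝ) ^ 2 - 1) := by linarith
    _ ≤ _ := one_div_le_one_div_of_le (by positivity) (by linarith)

/-- If `d = ⊤` then the bounds of all finite orders hold, and they tend to zero. -/
lemma le_mul_expDecay {x C K β : ℝ} {𝔡 : ℕ} {d : ℕ∞} (hρ : 1 < K * betaC 𝔡 / β)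
    (h : ∀ n : ℕ, (n : ℕ∞) ≤ d → x ≤ C * (1 / (K * betaC 𝔡 / β)) ^ n) :
    x ≤ C * expDecay d (markovLength K 𝔡 β) := by
  have hρ0 : 0 < K * betaC 𝔡 / β := by linarith
  by_cases hd : d = ⊤
  · rw [expDecay, if_pos hd]
    refine ge_of_tendsto' (f := fun n : ℕ => C * (1 / (K * betaC 𝔡 / β)) ^ n)
      (x := Filter.atTop) (Filter.Tendsto.const_mul C ?_) fun n => h n (hd ▸ le_top)
    exact tendsto_pow_atTop_nhds_zero_of_lt_one (by positivity) (by rwa [div_lt_one hρ0])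
  · have h1 := h d.toNat (ENat.natCast_toNat hd).le
    have h2 : Real.exp (-(d.toNat : ℝ) / (1 / Real.log (K * betaC 𝔡 / β))) =
        (1 / (K * betaC 𝔡 / β)) ^ d.toNat := by
      rw [div_div_eq_mul_div, div_one, neg_mul, Real.exp_neg, Real.exp_nat_mul, Real.exp_log hρ0,
        one_div, inv_pow]
    rwa [expDecay, if_neg hd, markovLength, h2]

end

end ClassicalCMI

theorem mainTheorem2 :
    ∃ c K : ℝ, 0 < c ∧ 1 < K ∧
      ∀ (V M : Type*) [Fintype V] [Fintype M] (q : ℕ) (_hq : 1 ≤ q)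
        (H : ClassicalCMI.DiagHamiltonian V M q)
        (𝔡 : ℕ) (_h𝔡 : 1 ≤ 𝔡) (_hdeg : ∀ a : M, (H.dualGraph.neighborSet a).ncard ≤ 𝔡)
        (β : ℝ) (_hβ : 0 < β) (_hβc : β ≤ ClassicalCMI.betaC 𝔡)
        (X Y Z : Finset V) (_hXY : Disjoint X Y) (_hYZ : Disjoint Y Z) (_hXZ : Disjoint X Z)
        (T : V → Matrix (Fin q) (Fin q) ℝ)
        (_hT : ∀ i ∈ Y, T i ∈ Matrix.colStochastic ℝ (Fin q))
        (_hT0 : ∀ i ∈ Y, ∀ x x', T i x x' ≠ 0),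
        ClassicalCMI.condMutualInfo
            (ClassicalCMI.applyTransition T Y (H.gibbs β)) X Z Y ≤
          c * (min (H.boundarySize X) (H.boundarySize Z) : ℕ) *
            ClassicalCMI.expDecay (H.clusterDist X Z) (ClassicalCMI.markovLength K 𝔡 β) := by
  have hK : 1 < 2 * Real.exp 1 / 5 := by linarith [Real.exp_one_gt_d9]
  refine ⟨3, 2 * Real.exp 1 / 5, by norm_num, hK, ?_⟩
  intro V M _ _ q hq H 𝔡 h𝔡 hdeg β hβ hβc X Y Z hXY hYZ hXZ T hT hT0
  have hρ : 1 < 2 * Real.exp 1 / 5 * ClassicalCMI.betaC 𝔡 / β := by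
    rw [lt_div_iff₀ hβ, one_mul]
    nlinarith
  have hρβ : 2 * Real.exp 1 / 5 * ClassicalCMI.betaC 𝔡 / β * β ≤ 1 / (5 * (𝔡 : ℝ) ^ 2) := by
    rw [div_mul_cancel₀ _ hβ.ne']
    exact ClassicalCMI.mul_betaC_le h𝔡
  have hnbrs : ∀ a, (H.nbrs a).card ≤ 𝔡 := fun a => (H.card_nbrs a).trans_le (hdeg a)
  have hR := ClassicalCMI.exp_inv_sub_one_le h𝔡
  refine ClassicalCMI.le_mul_expDecay hρ fun n hn => ?_
  rcases min_choice (H.boundarySize X) (H.boundarySize Z) with h | h <;> rw [h]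
  · exact H.condMutualInfo_gibbs_le hq h𝔡 hnbrs hR hρ hβ hρβ hXY hXZ hT hT0 hn
  · rw [ClassicalCMI.condMutualInfo_comm]
    exact H.condMutualInfo_gibbs_le hq h𝔡 hnbrs hR hρ hβ hρβ hYZ.symm hXZ.symm hT hT0
      (H.clusterDist_comm X Z ▸ hn)
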